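/- Let $n\ge 1$, let $[n]=\{1,\dots,n\}$ be a set of alternatives with the natural order as societal axis, and let $A\subseteq[n]$. The domain $D_{[n]}(A)$ generated by the set-alternating scheme of $A$ is the set of all linear (preference) orders on $[n]$ such that for every triple $i<j<k$ in $[n]$: if $j\in A$, the restriction of the order to $\{i,j,k\}$ does not rank $i$ last (never condition $1N3$); if $j\notin A$, it does not rank $k$ first (never condition $3N1$). For $n\ge 4$ the odd $1N33N1$-alternating scheme is the set-alternating scheme of $$B_n=\{2\}\cup\{\,j \text{ odd} : 3\le j\le n-3+(n \bmod 2)\,\}=\{2,3,5,7,\dots,n-3+(n\bmod 2)\},$$ where the list $3,5,\dots$ runs through odd numbers (so $B_4=\{2\}$). Then the odd $1N33N1$-alternating scheme generates domains of size $\Omega\big((\sqrt{2+2\sqrt2})^{\,n}\big)$: there are a real constant $c>0$ and an $N$ such that for all $n\ge N$ $$|D_{[n]}(B_n)|\ \ge\ c\,\Big(\sqrt{2+2\sqrt2}\Big)^{n}.$$ -/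

import Mathlib

namespace SetAlternating

/-- A preference order (linear order) on the alternatives `1, …, n`. The alternative `x` is
represented by the element of `Fin n` with value `x - 1`, and `P x` is the position at which
`P` ranks it, position `0` being the best one. The societal axis is the natural order of
`Fin n`. -/
abbrev PrefOrder (n : ℕ) : Type := Equiv.Perm (Fin n)

/-- The place (`1` = top, …, `#T` = bottom) that alternative `x` fills in the restriction of `P`
to the set `T` of alternatives, for `x ∈ T`. -/
def place {n : ℕ} (P : PrefOrder n) (T : Finset (Fin n)) (x : Fin n) : ℕ :=
  (T.filter (fun y => P y ≤ P x)).card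

/-- For a triple `i < j < k`, the order `P` satisfies `1N3`: the first alternative of the triple
along the axis does not fill the third place within the triple. -/
def Never1N3 {n : ℕ} (P : PrefOrder n) (i j k : Fin n) : Prop :=
  place P {i, j, k} i ≠ 3

/-- For a triple `i < j < k`, the order `P` satisfies `3N1`: the third alternative of the triple
along the axis does not fill the first place within the triple. -/
def Never3N1 {n : ℕ} (P : PrefOrder n) (i j k : Fin n) : Prop :=
  place P {i, j, k} k ≠ 1

/-- The never conditions of the set-alternating scheme generated by a set `A` of alternatives
(given by their labels in `{1, …, n}`): for `i < j < k`, `1N3` if `j ∈ A` and `3N1` if `j ∉ A`. -/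
def SatisfiesScheme (n : ℕ) (A : Finset ℕ) (P : PrefOrder n) : Prop :=
  ∀ i j k : Fin n, i < j → j < k →
    ((j : ℕ) + 1 ∈ A → Never1N3 P i j k) ∧ ((j : ℕ) + 1 ∉ A → Never3N1 P i j k)

/-- The domain generated by the set-alternating scheme of `A`: all preference orders on `n`
alternatives that satisfy its never conditions. -/
def domain (n : ℕ) (A : Finset ℕ) : Set (PrefOrder n) :=
  {P | SatisfiesScheme n A P}

/-- The set `{2, 3, 5, 7, …, n - 3 + (n mod 2)}` generating the odd `1N33N1`-alternating scheme:
the number `2` together with all odd numbers from `3` to `n - 3 + (n mod 2)`. -/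
def oddSchemeSet (n : ℕ) : Finset ℕ :=
  insert 2 ((Finset.Icc 3 (n - 3 + n % 2)).filter (fun j => Odd j))

end SetAlternating

/-!
The domain on the alternatives `1, …, m + 1` is obtained from the domain on `1, …, m` by inserting
the largest alternative. An insertion above the `d` bottom alternatives stays in the domain if no two
of the old alternatives break a never condition together with the new one (`DepthOK`), and the
admissible depths form an initial segment `0, …, T` of the natural numbers. The number `T` (`depth`)
is all that matters for further insertions: when the inserted label belongs to the generating set,
depth `0` leads to at least `T + 1` and each of the `T` other depths leads to at least `0`; when it does not
belong to it, depth `d` leads to at least `max d 1`.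

In the odd scheme, labels inside and outside the generating set alternate, so apart from a bounded
number of insertions at the two ends the size of the domain is bounded below by iterates of the
two-step operator `T ↦ (T + 1) g 1 + ∑_{s = 1}^{T + 1} g s` (`twoStep`) applied to the constant
function `1`. This operator has the positive eigenfunction `h T = √2 ^ (T + 1) - 1` with eigenvalue
`μ = 2 + 2 √2` (`twoStep_eigen`). As `h` is unbounded, it cannot itself be used as a lower bound for
the constant `1`. The function `2 ^ T`, which dominates `h ^ 2 / 2`, grows by a factor of only `4`
under the operator, up to a multiple of `h` (`twoStep_two_pow`). Since `4 < μ`, starting from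
`1 ≥ h / 8 - 2 ^ T / 128` and iterating gives a lower bound of the order of `μ ^ j` for the `j`-th
iterate (`le_iterate_twoStep`), and `μ` is the square of the growth rate claimed.
-/

namespace SetAlternating

/-! ### The never conditions in terms of positions -/

lemma place_eq {n : ℕ} (P : PrefOrder n) {i j k : Fin n} (hij : i ≠ j) (hik : i ≠ k) (hjk : j ≠ k)
    (x : Fin n) :
    place P {i, j, k} x = (if P i ≤ P x then 1 else 0) + (if P j ≤ P x then 1 else 0)
      + (if P k ≤ P x then 1 else 0) := by
  rw [place, Finset.card_filter, Finset.sum_insert (by simp [hij, hik]),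
    Finset.sum_insert (by simp [hjk]), Finset.sum_singleton, add_assoc]

lemma never1N3_iff {n : ℕ} (P : PrefOrder n) {i j k : Fin n} (hij : i < j) (hjk : j < k) :
    Never1N3 P i j k ↔ ¬ (P j < P i ∧ P k < P i) := by
  have h1 : P j ≠ P i := P.injective.ne hij.ne'
  have h2 : P k ≠ P i := P.injective.ne (hij.trans hjk).ne'
  rw [Never1N3, place_eq P hij.ne (hij.trans hjk).ne hjk.ne, lt_iff_le_and_ne, lt_iff_le_and_ne]
  by_cases h3 : P j ≤ P i <;> by_cases h4 : P k ≤ P i <;> simp [h1, h2, h3, h4]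

lemma never3N1_iff {n : ℕ} (P : PrefOrder n) {i j k : Fin n} (hij : i < j) (hjk : j < k) :
    Never3N1 P i j k ↔ ¬ (P k < P i ∧ P k < P j) := by
  rw [Never3N1, place_eq P hij.ne (hij.trans hjk).ne hjk.ne, ← not_le, ← not_le]
  by_cases h3 : P i ≤ P k <;> by_cases h4 : P j ≤ P k <;> simp [h3, h4]

lemma mem_domain_iff {n : ℕ} {A : Finset ℕ} {P : PrefOrder n} :
    P ∈ domain n A ↔ ∀ i j k : Fin n, i < j → j < k →
      ((j : ℕ) + 1 ∈ A → ¬ (P j < P i ∧ P k < P i)) ∧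
      ((j : ℕ) + 1 ∉ A → ¬ (P k < P i ∧ P k < P j)) := by
  refine forall_congr' fun i => forall_congr' fun j => forall_congr' fun k =>
    forall_congr' fun hij => forall_congr' fun hjk => ?_
  rw [never1N3_iff P hij hjk, never3N1_iff P hij hjk]

/-! ### Inserting the largest alternative -/

/-- The preference order on `m + 1` alternatives that ranks the largest alternative at position `p`
and the others as `P` does. -/
def insertLast {m : ℕ} (P : PrefOrder m) (p : Fin (m + 1)) : PrefOrder (m + 1) :=
  finSuccEquivLast.trans ((Equiv.optionCongr P).trans (finSuccEquiv' p).symm)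

@[simp] lemma insertLast_last {m : ℕ} (P : PrefOrder m) (p : Fin (m + 1)) :
    insertLast P p (Fin.last m) = p := by
  simp [insertLast]

@[simp] lemma insertLast_castSucc {m : ℕ} (P : PrefOrder m) (p : Fin (m + 1)) (x : Fin m) :
    insertLast P p x.castSucc = p.succAbove (P x) := by
  simp [insertLast]

lemma insertLast_injective {m : ℕ} {P P' : PrefOrder m} {p p' : Fin (m + 1)}
    (h : insertLast P p = insertLast P' p') : P = P' ∧ p = p' := by
  have hp : p = p' := by
    simpa using congrArg (fun Q : PrefOrder (m + 1) => Q (Fin.last m)) h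
  subst hp
  refine ⟨Equiv.ext fun x => ?_, rfl⟩
  simpa using congrArg (fun Q : PrefOrder (m + 1) => Q x.castSucc) h

/-- The position with exactly `d` of the `m` old alternatives below it (for `d ≤ m`). -/
def posOfDepth (m d : ℕ) : Fin (m + 1) := ⟨m - d, by omega⟩

/-- The never conditions satisfied by `P` survive the insertion of a largest alternative above the
`d` bottom alternatives: for `i < j` with `i` among the bottom `d`, if `j` lies in the generating set
then `P` ranks `i` above `j`, and `j` does lie in it if it is also among the bottom `d`. -/
def DepthOK {m : ℕ} (A : Finset ℕ) (P : PrefOrder m) (d : ℕ) : Prop :=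
  ∀ i j : Fin m, i < j → m ≤ (P i : ℕ) + d →
    ((j : ℕ) + 1 ∈ A → P i < P j) ∧ (m ≤ (P j : ℕ) + d → (j : ℕ) + 1 ∈ A)

lemma depthOK_zero {m : ℕ} (A : Finset ℕ) (P : PrefOrder m) : DepthOK A P 0 :=
  fun i _ _ h => absurd (P i).isLt (by omega)

lemma DepthOK.mono {m : ℕ} {A : Finset ℕ} {P : PrefOrder m} {d e : ℕ} (h : DepthOK A P e)
    (hde : d ≤ e) : DepthOK A P d :=
  fun i j hij hi => ⟨(h i j hij (by omega)).1, fun hj => (h i j hij (by omega)).2 (by omega)⟩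

lemma posOfDepth_lt_succAbove_iff {m d : ℕ} (x : Fin m) :
    posOfDepth m d < (posOfDepth m d).succAbove x ↔ m ≤ (x : ℕ) + d := by
  rw [Fin.lt_succAbove_iff_le_castSucc, Fin.le_def]
  simp only [posOfDepth, Fin.val_castSucc]
  omega

lemma insertLast_mem_domain {m d : ℕ} {A : Finset ℕ} {P : PrefOrder m} (hP : P ∈ domain m A)
    (h : DepthOK A P d) : insertLast P (posOfDepth m d) ∈ domain (m + 1) A := by
  rw [mem_domain_iff] at hP ⊢
  intro i j k hij hjk
  induction i using Fin.lastCases with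
  | last => exact absurd (hij.trans hjk) (Fin.le_last _).not_gt
  | cast i =>
  induction j using Fin.lastCases with
  | last => exact absurd hjk (Fin.le_last _).not_gt
  | cast j =>
  have hij' : i < j := hij
  induction k using Fin.lastCases with
  | last =>
    simp only [insertLast_last, insertLast_castSucc, posOfDepth_lt_succAbove_iff,
      Fin.succAbove_lt_succAbove_iff, Fin.val_castSucc]
    exact ⟨fun hj hh => lt_asymm hh.1 ((h i j hij' hh.2).1 hj),
      fun hj hh => hj ((h i j hij' hh.1).2 hh.2)⟩
  | cast k =>
    simpa only [insertLast_castSucc, Fin.succAbove_lt_succAbove_iff, Fin.val_castSucc] using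
      hP i j k hij' hjk

lemma depthOK_insertLast_of_mem {m T : ℕ} {A : Finset ℕ} {P : PrefOrder m} (h : DepthOK A P T)
    (hm : m + 1 ∈ A) : DepthOK A (insertLast P (posOfDepth m 0)) (T + 1) := by
  have hp : posOfDepth m 0 = Fin.last m := rfl
  intro i j hij hi
  induction i using Fin.lastCases with
  | last => exact absurd hij (Fin.le_last _).not_gt
  | cast i =>
  induction j using Fin.lastCases with
  | last => simp [hp, hm, Fin.castSucc_lt_last]
  | cast j =>
    simp only [hp, insertLast_castSucc, Fin.succAbove_last, Fin.val_castSucc,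
      Fin.castSucc_lt_castSucc_iff] at hi ⊢
    have := h i j hij (by omega)
    exact ⟨this.1, fun hj => this.2 (by omega)⟩

lemma depthOK_insertLast_one {m : ℕ} (A : Finset ℕ) (P : PrefOrder m) :
    DepthOK A (insertLast P (posOfDepth m 0)) 1 := by
  have hp : posOfDepth m 0 = Fin.last m := rfl
  intro i j hij hi
  induction i using Fin.lastCases with
  | last => exact absurd hij (Fin.le_last _).not_gt
  | cast i =>
    simp only [hp, insertLast_castSucc, Fin.succAbove_last, Fin.val_castSucc] at hi
    exact absurd (P i).isLt (by omega)

lemma depthOK_insertLast_of_notMem {m d : ℕ} {A : Finset ℕ} {P : PrefOrder m}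
    (h : DepthOK A P d) (hd : d ≤ m) (hm : m + 1 ∉ A) :
    DepthOK A (insertLast P (posOfDepth m d)) d := by
  have key : ∀ x : Fin m, m + 1 ≤ ((posOfDepth m d).succAbove (P x) : ℕ) + d →
      m ≤ (P x : ℕ) + d := fun x hx => by
    rw [← posOfDepth_lt_succAbove_iff, Fin.lt_def]
    simp only [posOfDepth] at hx ⊢
    omega
  intro i j hij hi
  induction i using Fin.lastCases with
  | last => exact absurd hij (Fin.le_last _).not_gt
  | cast i =>
  rw [insertLast_castSucc] at hi
  induction j using Fin.lastCases with
  | last =>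
    refine ⟨fun hj => absurd hj hm, fun hj => ?_⟩
    rw [insertLast_last] at hj
    simp only [posOfDepth] at hj
    omega
  | cast j =>
    simp only [insertLast_castSucc, Fin.succAbove_lt_succAbove_iff, Fin.val_castSucc]
    have := h i j hij (key i hi)
    exact ⟨this.1, fun hj => this.2 (key j hj)⟩

/-! ### Sums over the domain and the succession rule -/

open scoped Classical in
/-- The largest depth at which a new largest alternative can be inserted into `P`. -/
noncomputable def depth {m : ℕ} (A : Finset ℕ) (P : PrefOrder m) : ℕ :=
  Nat.findGreatest (DepthOK A P) m

lemma depthOK_depth {m : ℕ} (A : Finset ℕ) (P : PrefOrder m) : DepthOK A P (depth A P) := by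
  classical
  exact Nat.findGreatest_spec (Nat.zero_le m) (depthOK_zero A P)

lemma depth_le {m : ℕ} (A : Finset ℕ) (P : PrefOrder m) : depth A P ≤ m := by
  classical
  exact Nat.findGreatest_le m

lemma DepthOK.le_depth {m d : ℕ} {A : Finset ℕ} {P : PrefOrder m} (h : DepthOK A P d)
    (hd : d ≤ m) : d ≤ depth A P := by
  classical
  exact Nat.le_findGreatest hd h

open scoped Classical in
/-- The sum of `g (depth A P)` over the domain generated by `A` on `m` alternatives. -/
noncomputable def depthSum (A : Finset ℕ) (m : ℕ) (g : ℕ → ℝ) : ℝ :=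
  ∑ P : PrefOrder m with P ∈ domain m A, g (depth A P)

lemma depthSum_one (A : Finset ℕ) (m : ℕ) :
    depthSum A m (fun _ => 1) = ((domain m A).ncard : ℝ) := by
  classical
  rw [depthSum, Finset.sum_const, nsmul_eq_mul, mul_one, ← Set.ncard_coe_finset]
  congr 2
  ext P
  simp

lemma depthSum_mono {A : Finset ℕ} {m : ℕ} {g g' : ℕ → ℝ} (h : ∀ T, g T ≤ g' T) :
    depthSum A m g ≤ depthSum A m g' :=
  Finset.sum_le_sum fun _ _ => h _

/-- If `next T d` bounds from below the new depth after an insertion at depth `d` into an order of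
depth `T`, then summing over all insertions bounds from below the sum over the larger domain. -/
lemma depthSum_succ_ge {A : Finset ℕ} {m : ℕ} {g : ℕ → ℝ} (hg : Monotone g) (hg0 : ∀ T, 0 ≤ g T)
    (next : ℕ → ℕ → ℕ)
    (hnext : ∀ P : PrefOrder m, ∀ d ≤ depth A P,
      next (depth A P) d ≤ depth A (insertLast P (posOfDepth m d))) :
    depthSum A m (fun T => ∑ d ∈ Finset.range (T + 1), g (next T d)) ≤ depthSum A (m + 1) g := by
  classical
  unfold depthSum
  rw [Finset.sum_sigma']
  let F : (_ : PrefOrder m) × ℕ → PrefOrder (m + 1) := fun x => insertLast x.1 (posOfDepth m x.2)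
  refine (Finset.sum_le_sum (g := fun x => g (depth A (F x))) fun x hx => hg ?_).trans ?_
  · simp only [Finset.mem_sigma, Finset.mem_range] at hx
    exact hnext _ _ (by omega)
  rw [← Finset.sum_image (f := fun Q => g (depth A Q)) (g := F)]
  · refine Finset.sum_le_sum_of_subset_of_nonneg ?_ fun _ _ _ => hg0 _
    intro Q hQ
    obtain ⟨x, hx, rfl⟩ := Finset.mem_image.1 hQ
    simp only [Finset.mem_sigma, Finset.mem_range, Finset.mem_filter, Finset.mem_univ,
      true_and] at hx ⊢
    exact insertLast_mem_domain hx.1 ((depthOK_depth A x.1).mono (by omega))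
  · rintro ⟨P, d⟩ hx ⟨P', d'⟩ hx' hF
    simp only [Finset.coe_sigma, Set.mem_sigma_iff, Finset.mem_coe, Finset.mem_range] at hx hx'
    obtain ⟨rfl, hp⟩ := insertLast_injective hF
    have hdm : depth A P ≤ m := depth_le A P
    simp only at hx hx'
    have hp' : m - d = m - d' := congrArg Fin.val hp
    obtain rfl : d = d' := by omega
    rfl

lemma depthSum_succ_ge_of_mem {A : Finset ℕ} {m : ℕ} (hm : m + 1 ∈ A) {g : ℕ → ℝ}
    (hg : Monotone g) (hg0 : ∀ T, 0 ≤ g T) :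
    depthSum A m (fun T => g (T + 1) + T * g 0) ≤ depthSum A (m + 1) g := by
  refine le_trans (depthSum_mono fun T => ?_)
    (depthSum_succ_ge hg hg0 (fun T d => if d = 0 then T + 1 else 0) fun P d hd => ?_)
  · rw [Finset.sum_range_succ']
    simp [add_comm]
  · split_ifs with h
    · subst h
      exact (depthOK_insertLast_of_mem (depthOK_depth A P) hm).le_depth (by simpa using depth_le A P)
    · exact Nat.zero_le _

lemma depthSum_succ_ge_of_notMem {A : Finset ℕ} {m : ℕ} (hm : m + 1 ∉ A) {g : ℕ → ℝ}
    (hg : Monotone g) (hg0 : ∀ T, 0 ≤ g T) :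
    depthSum A m (fun T => g 1 + ∑ s ∈ Finset.range T, g (s + 1)) ≤ depthSum A (m + 1) g := by
  refine le_trans (depthSum_mono fun T => ?_)
    (depthSum_succ_ge hg hg0 (fun _ d => max d 1) fun P d hd => ?_)
  · rw [Finset.sum_range_succ']
    simp [add_comm]
  · have := depth_le A P
    rcases Nat.eq_zero_or_pos d with rfl | h
    · exact (depthOK_insertLast_one A P).le_depth (by omega)
    · rw [max_eq_left h]
      exact (depthOK_insertLast_of_notMem ((depthOK_depth A P).mono hd) (by omega) hm).le_depth
        (by omega)

lemma ncard_domain_succ_ge (A : Finset ℕ) (m : ℕ) :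
    ((domain m A).ncard : ℝ) ≤ ((domain (m + 1) A).ncard : ℝ) := by
  rw [← depthSum_one, ← depthSum_one]
  refine le_trans (depthSum_mono fun T => ?_) (depthSum_succ_ge monotone_const
    (fun _ => zero_le_one) (fun _ _ => 0) fun _ _ _ => Nat.zero_le _)
  simp

/-! ### The two-step operator -/

/-- The effect on a function of the depth of inserting first an alternative inside and then one
outside the generating set. -/
noncomputable def twoStep (g : ℕ → ℝ) (T : ℕ) : ℝ :=
  (T + 1) * g 1 + ∑ s ∈ Finset.range (T + 1), g (s + 1)

lemma twoStep_mono {g g' : ℕ → ℝ} (h : ∀ T, g T ≤ g' T) (T : ℕ) : twoStep g T ≤ twoStep g' T :=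
  add_le_add (mul_le_mul_of_nonneg_left (h 1) (by positivity)) (Finset.sum_le_sum fun _ _ => h _)

lemma twoStep_nonneg {g : ℕ → ℝ} (hg : ∀ T, 0 ≤ g T) (T : ℕ) : 0 ≤ twoStep g T :=
  add_nonneg (mul_nonneg (by positivity) (hg 1)) (Finset.sum_nonneg fun _ _ => hg _)

lemma monotone_twoStep {g : ℕ → ℝ} (hg : ∀ T, 0 ≤ g T) : Monotone (twoStep g) := by
  refine monotone_nat_of_le_succ fun T => ?_
  unfold twoStep
  rw [Finset.sum_range_succ _ (T + 1)]
  push_cast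
  linarith [hg 1, hg (T + 1 + 1)]

lemma twoStep_sub (a b : ℝ) (g g' : ℕ → ℝ) (T : ℕ) :
    twoStep (fun s => a * g s - b * g' s) T = a * twoStep g T - b * twoStep g' T := by
  simp only [twoStep, Finset.sum_sub_distrib, ← Finset.mul_sum]
  ring

lemma depthSum_twoStep_le {A : Finset ℕ} {m : ℕ} (hm : m + 1 ∈ A) (hm' : m + 2 ∉ A) {g : ℕ → ℝ}
    (hg : Monotone g) (hg0 : ∀ T, 0 ≤ g T) :
    depthSum A m (twoStep g) ≤ depthSum A (m + 2) g := by
  refine le_trans ?_ (depthSum_succ_ge_of_notMem hm' hg hg0)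
  refine le_trans (depthSum_mono fun T => ?_) (depthSum_succ_ge_of_mem hm ?_ ?_)
  · simp only [twoStep, Finset.sum_range_zero]
    linarith
  · refine monotone_nat_of_le_succ fun T => ?_
    rw [Finset.sum_range_succ]
    linarith [hg0 (T + 1)]
  · exact fun T => add_nonneg (hg0 1) (Finset.sum_nonneg fun _ _ => hg0 _)

/-- The function `h T = √2 ^ (T + 1) - 1` is an eigenfunction of the two-step operator. -/
lemma twoStep_eigen (T : ℕ) :
    twoStep (fun s => √2 ^ (s + 1) - 1) T = (2 + 2 * √2) * (√2 ^ (T + 1) - 1) := by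
  have h2 : √2 ^ 2 = 2 := Real.sq_sqrt (by norm_num)
  induction T with
  | zero =>
    simp only [twoStep, Finset.sum_range_succ, Finset.sum_range_zero]
    norm_num
    linarith [h2]
  | succ T ih =>
    unfold twoStep at ih ⊢
    rw [Finset.sum_range_succ _ (T + 1)]
    push_cast
    have e1 : √2 ^ (T + 1 + 1 + 1) = 2 * √2 ^ (T + 1) := by
      rw [pow_succ, pow_succ, mul_assoc, ← sq, h2]
      ring
    have e2 : √2 ^ (T + 1 + 1) = √2 ^ (T + 1) * √2 := pow_succ _ _
    rw [e1, e2]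
    linear_combination ih + (1 - 2 * √2 ^ (T + 1)) * h2

lemma twoStep_two_pow (T : ℕ) : twoStep (fun s => 2 ^ s) T = 4 * 2 ^ T + 2 * T := by
  induction T with
  | zero => norm_num [twoStep]
  | succ T ih =>
    unfold twoStep at ih ⊢
    rw [Finset.sum_range_succ _ (T + 1)]
    push_cast
    rw [pow_succ _ (T + 1)]
    linear_combination ih

lemma sqrt_two_bounds : 1.4 ≤ √2 ∧ √2 ≤ 1.5 :=
  ⟨Real.le_sqrt_of_sq_le (by norm_num), Real.sqrt_le_iff.2 (by norm_num)⟩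

lemma two_mul_le_eigen (T : ℕ) : 2 * (T : ℝ) ≤ 5 * (√2 ^ (T + 1) - 1) := by
  have := one_add_mul_le_pow (a := √2 - 1) (by linarith [sqrt_two_bounds.1]) (T + 1)
  push_cast at this
  rw [add_sub_cancel] at this
  nlinarith [sqrt_two_bounds.1, (Nat.cast_nonneg T : (0 : ℝ) ≤ T)]

/-- The lower bound propagated by the two-step operator. The coefficient of the eigenfunction starts
at `1 / 8`; each step multiplies it by `μ = 2 + 2 √2` and then costs at most `5 / 128 * 4 ^ j`. Since
`(μ - 4) / 16 ≥ 5 / 128`, the summand `4 ^ j / 16` absorbs this loss. -/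
lemma le_iterate_twoStep (j T : ℕ) :
    ((2 + 2 * √2) ^ j / 16 + 4 ^ j / 16) * (√2 ^ (T + 1) - 1) - 4 ^ j / 128 * 2 ^ T
      ≤ twoStep^[j] (fun _ => 1) T := by
  induction j generalizing T with
  | zero =>
    have hs : (√2 ^ (T + 1)) ^ 2 = 2 * 2 ^ T := by
      rw [← pow_mul, mul_comm, pow_mul, Real.sq_sqrt (by norm_num), pow_succ']
    have h1 : 1 ≤ √2 ^ (T + 1) := one_le_pow₀ (by linarith [sqrt_two_bounds.1])
    simp only [pow_zero, Function.iterate_zero, id]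
    -- `h ≤ 8 + h ^ 2 / 32` by completing the square, and `h ^ 2 ≤ 2 * 2 ^ T`
    nlinarith [sq_nonneg (√2 ^ (T + 1) - 1 - 16)]
  | succ j ih =>
    rw [Function.iterate_succ_apply']
    refine le_trans ?_ (twoStep_mono ih T)
    rw [twoStep_sub _ _ (fun s => √2 ^ (s + 1) - 1) (fun s => 2 ^ s), twoStep_eigen,
      twoStep_two_pow]
    have h1 : 0 ≤ √2 ^ (T + 1) - 1 :=
      sub_nonneg.2 (one_le_pow₀ (by linarith [sqrt_two_bounds.1]))
    have h4 : (0 : ℝ) < 4 ^ j := by positivity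
    have h5 := mul_le_mul_of_nonneg_left (two_mul_le_eigen T) h4.le
    have h6 := mul_nonneg (mul_nonneg h4.le h1) (sub_nonneg.2 sqrt_two_bounds.1)
    rw [pow_succ, pow_succ]
    nlinarith [mul_nonneg h4.le h1]

lemma iterate_twoStep_nonneg (j T : ℕ) : 0 ≤ twoStep^[j] (fun _ => 1) T := by
  induction j generalizing T with
  | zero => exact zero_le_one
  | succ j ih =>
    rw [Function.iterate_succ_apply']
    exact twoStep_nonneg ih T

lemma monotone_iterate_twoStep (j : ℕ) : Monotone (twoStep^[j] (fun _ => 1)) := by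
  cases j with
  | zero => exact monotone_const
  | succ j =>
    rw [Function.iterate_succ']
    exact monotone_twoStep (iterate_twoStep_nonneg j)

lemma iterate_twoStep_zero_ge (j : ℕ) :
    (2 + 2 * √2) ^ j / 40 ≤ twoStep^[j] (fun _ => 1) 0 := by
  refine le_trans ?_ (le_iterate_twoStep j 0)
  have h1 := sqrt_two_bounds.1
  have h4 : (0 : ℝ) < 4 ^ j := by positivity
  have h5 : 0 ≤ (2 + 2 * √2) ^ j := by positivity
  simp only [zero_add, pow_one, pow_zero]
  nlinarith [mul_nonneg h4.le (sub_nonneg.2 h1), mul_nonneg h5 (sub_nonneg.2 h1)]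

/-! ### The size of the domain of the odd scheme -/

/-- If labels inside and outside the generating set alternate from the label `3` on, for `j` pairs of
labels, then these pairs contribute `j` iterations of the two-step operator. -/
lemma ncard_domain_ge_of_alternating {A : Finset ℕ} {j : ℕ} (h : ∀ i < j, 2 * i + 3 ∈ A)
    (h' : ∀ i < j, 2 * i + 4 ∉ A) :
    (2 + 2 * √2) ^ j / 40 ≤ ((domain (2 * j + 2) A).ncard : ℝ) := by
  classical
  have key : ∀ i ≤ j, depthSum A (2 * (j - i) + 2) (twoStep^[i] (fun _ => 1))
      ≤ depthSum A (2 * j + 2) (fun _ => 1) := by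
    intro i hi
    induction i with
    | zero => exact le_rfl
    | succ i ih =>
      refine le_trans ?_ (ih (by omega))
      obtain ⟨l, rfl⟩ : ∃ l, j = l + i + 1 := ⟨j - (i + 1), by omega⟩
      have e1 : 2 * (l + i + 1 - (i + 1)) + 2 = 2 * l + 2 := by omega
      have e2 : 2 * (l + i + 1 - i) + 2 = 2 * l + 2 + 2 := by omega
      rw [Function.iterate_succ', e1, e2]
      exact depthSum_twoStep_le (h l (by omega)) (h' l (by omega)) (monotone_iterate_twoStep i)
        (iterate_twoStep_nonneg i)
  rw [← depthSum_one]
  refine le_trans (iterate_twoStep_zero_ge j) (le_trans ?_ (key j le_rfl))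
  rw [Nat.sub_self]
  -- every order on two alternatives lies in the domain, as there are no triples
  have hmem : (1 : PrefOrder 2) ∈ domain 2 A := fun i j k hij hjk => by omega
  refine le_trans (monotone_iterate_twoStep j (Nat.zero_le (depth A (1 : PrefOrder 2)))) ?_
  exact Finset.single_le_sum
    (f := fun P : PrefOrder 2 => twoStep^[j] (fun _ => 1) (depth A P))
    (fun _ _ => iterate_twoStep_nonneg j _) (by simpa using hmem)

lemma mem_oddSchemeSet_iff {n a : ℕ} :
    a ∈ oddSchemeSet n ↔ a = 2 ∨ (3 ≤ a ∧ a ≤ n - 3 + n % 2) ∧ Odd a := by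
  simp [oddSchemeSet]

end SetAlternating

theorem mainTheorem2 :
    ∃ c : ℝ, 0 < c ∧ ∃ N : ℕ, ∀ n : ℕ, N ≤ n →
      c * Real.sqrt (2 + 2 * Real.sqrt 2) ^ n
        ≤ ((SetAlternating.domain n (SetAlternating.oddSchemeSet n)).ncard : ℝ) := by
  open SetAlternating in
  have hpos : (0 : ℝ) ≤ 2 + 2 * √2 := by positivity
  have hρ : 1 ≤ √(2 + 2 * √2) := Real.one_le_sqrt.2 (by linarith [Real.sqrt_nonneg 2])
  refine ⟨1 / (40 * √(2 + 2 * √2) ^ 4), by positivity, 4, fun n hn => ?_⟩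
  -- `j` is the number of complete pairs `(3, 4), (5, 6), …` whose odd member is in the scheme
  obtain ⟨j, r, rfl, hr, hj⟩ : ∃ j r, n = 2 * j + 2 + r ∧ r ≤ 2 ∧ 2 * j + 1 = n - 3 + n % 2 :=
    ⟨(n - 4 + n % 2) / 2, n - 2 - 2 * ((n - 4 + n % 2) / 2), by omega, by omega, by omega⟩
  have hmono : Monotone fun m => ((domain m (oddSchemeSet (2 * j + 2 + r))).ncard : ℝ) :=
    monotone_nat_of_le_succ fun m => ncard_domain_succ_ge _ m
  refine le_trans ?_ (hmono (Nat.le_add_right (2 * j + 2) r))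
  refine le_trans ?_ (ncard_domain_ge_of_alternating (j := j) (fun i hi => ?_) fun i hi => ?_)
  · rw [div_mul_eq_mul_div, one_mul, div_le_div_iff₀ (by positivity) (by norm_num)]
    calc √(2 + 2 * √2) ^ (2 * j + 2 + r) * 40
        ≤ √(2 + 2 * √2) ^ (2 * j + 4) * 40 :=
          mul_le_mul_of_nonneg_right (pow_le_pow_right₀ hρ (by omega)) (by norm_num)
      _ = (2 + 2 * √2) ^ j * (40 * √(2 + 2 * √2) ^ 4) := by
          rw [pow_add, pow_mul, Real.sq_sqrt hpos]
          ring
  · exact mem_oddSchemeSet_iff.2 (Or.inr ⟨by omega, ⟨i + 1, by ring⟩⟩)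
  · rw [mem_oddSchemeSet_iff]
    rintro (h | ⟨-, k, hk⟩) <;> omega
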